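/- Let $\mathbb{F}_{q^s}/\mathbb{F}_q$ be an extension of finite fields of degree $s\ge 1$, and let $m\ge 1$. Let $P^m\subset\mathbb{F}_{q^s}^{m+1}$ be the set of vectors whose first nonzero coordinate from the left is equal to $1$ (representatives of the points of the projective space $\mathbb{P}^m$ over $\mathbb{F}_{q^s}$). For $d\ge 1$, let $\mathrm{PRM}_d(m)\subset \mathbb{F}_{q^s}^{P^m}$ be the projective Reed–Muller code, consisting of the evaluations $(f(Q))_{Q\in P^m}$ of all homogeneous polynomials $f\in\mathbb{F}_{q^s}[x_0,\dots,x_m]$ of degree $d$ (including $f=0$). For $d\ge 0$, let $\mathrm{RM}_d(m)\subset \mathbb{F}_{q^s}^{\mathbb{F}_{q^s}^m}$ be the affine Reed–Muller code, consisting of the evaluations $(f(Q))_{Q\in \mathbb{F}_{q^s}^m}$ of all polynomials $f\in\mathbb{F}_{q^s}[x_1,\dots,x_m]$ of total degree at most $d$. For a linear code $C\subset\mathbb{F}_{q^s}^n$, let $C^\sigma=C\cap\mathbb{F}_q^n$ be its subfield subcode, a linear code over $\mathbb{F}_q$. For a nonzero linear code $C$, let $d_1(C)$ be its minimum (Hamming)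 distance. A linear code is called non-degenerate if no coordinate is zero in all of its codewords. Let $1\le d\le m(q^s-1)$. Then $$ d_1(\mathrm{RM}_{d-1}(m))\le d_1(\mathrm{PRM}_d^\sigma(m))\le d_1(\mathrm{RM}_{d-1}^\sigma(m)), $$ $$ \dim_{\mathbb{F}_q}\mathrm{PRM}_d^\sigma(m)\ge \dim_{\mathbb{F}_q}\mathrm{RM}_{d-1}^\sigma(m), $$ and the last inequality is strict if $\mathrm{PRM}_d^\sigma(m)$ is non-degenerate. -/

import Mathlib

namespace ReedMuller

/-- The set `P^m` of standard representatives of the points of the projective space `ℙ^m` over `K`: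
the vectors of `K^(m+1)` whose first nonzero coordinate from the left is equal to `1`. -/
abbrev ProjPoint (K : Type*) [Field K] (m : ℕ) : Type _ :=
  {Q : Fin (m + 1) → K // ∃ i, Q i = 1 ∧ ∀ j < i, Q j = 0}

/-- Evaluation of polynomials in `m + 1` variables at the standard representatives `P^m`. -/
noncomputable def projEval (K : Type*) [Field K] (m : ℕ) :
    MvPolynomial (Fin (m + 1)) K →ₗ[K] (ProjPoint K m → K) :=
  LinearMap.pi fun Q => (MvPolynomial.aeval Q.1).toLinearMap

/-- Evaluation of polynomials in `m` variables at all the points of `K^m`. -/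
noncomputable def affEval (K : Type*) [Field K] (m : ℕ) :
    MvPolynomial (Fin m) K →ₗ[K] ((Fin m → K) → K) :=
  LinearMap.pi fun Q => (MvPolynomial.aeval Q).toLinearMap

/-- The projective Reed-Muller code `PRM_d(m)` over `K`: evaluations at `P^m` of the homogeneous
polynomials of degree `d` (and zero). -/
noncomputable def PRM (K : Type*) [Field K] (d m : ℕ) : Submodule K (ProjPoint K m → K) :=
  (MvPolynomial.homogeneousSubmodule (Fin (m + 1)) K d).map (projEval K m)

/-- The affine Reed-Muller code `RM_d(m)` over `K`: evaluations at `K^m` of the polynomials of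
total degree at most `d`. -/
noncomputable def RM (K : Type*) [Field K] (d m : ℕ) : Submodule K ((Fin m → K) → K) :=
  (MvPolynomial.restrictTotalDegree (Fin m) K d).map (affEval K m)

/-- The subfield subcode `C^σ = C ∩ F^n` of a linear code `C ⊆ K^n`, for an extension `K` of `F`,
as an `F`-linear code of length `n`. -/
def subfieldSubcode (F : Type*) {K ι : Type*} [Field F] [Field K] [Algebra F K]
    (C : Submodule K (ι → K)) : Submodule F (ι → F) where
  carrier := {c | (fun i => algebraMap F K (c i)) ∈ C}
  zero_mem' := by
    have h : (fun i => algebraMap F K ((0 : ι → F) i)) = 0 := by ext; simp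
    simp only [Set.mem_ofPred_eq, h, C.zero_mem]
  add_mem' {a b} ha hb := by
    have h : (fun i => algebraMap F K ((a + b) i)) =
        (fun i => algebraMap F K (a i)) + fun i => algebraMap F K (b i) := by ext; simp
    simp only [Set.mem_ofPred_eq, h]
    exact C.add_mem ha hb
  smul_mem' r a ha := by
    have h : (fun i => algebraMap F K ((r • a) i)) =
        algebraMap F K r • fun i => algebraMap F K (a i) := by ext; simp
    simp only [Set.mem_ofPred_eq, h]
    exact C.smul_mem _ ha

/-- The minimum distance `d_1(C)`: the least Hamming distance between distinct codewords of `C`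
(only meaningful if `C ≠ 0`; for `C = 0` the value is `0`). -/
noncomputable def minDist {k ι : Type*} [Field k] [DecidableEq k] [Fintype ι]
    (C : Submodule k (ι → k)) : ℕ :=
  sInf {n | ∃ x ∈ C, ∃ y ∈ C, x ≠ y ∧ hammingDist x y = n}

/-- A linear code is non-degenerate if no coordinate vanishes on all codewords, i.e. if its support
is the whole set of coordinates. -/
def Nondegenerate {k ι : Type*} [Field k] (C : Submodule k (ι → k)) : Prop :=
  ∀ i, ∃ c ∈ C, c i ≠ 0

/-- The constant word `1` lies in `RM_d^σ(m)`, so this code is nonzero and `minDist` is a genuine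
minimum for it. -/
theorem one_mem_subfieldSubcode_RM (F K : Type*) [Field F] [Field K] [Algebra F K] (d m : ℕ) :
    (1 : (Fin m → K) → F) ∈ subfieldSubcode F (RM K d m) := by
  refine ⟨1, ?_, ?_⟩
  · simp [MvPolynomial.mem_restrictTotalDegree]
  · ext Q
    simp [affEval]

end ReedMuller

namespace ReedMuller

/-! ### Minimum distance as minimum weight. -/

section MinDist

variable {k ι : Type*} [Field k] [DecidableEq k] [Fintype ι]

/-! Homogenising a polynomial of degree at most `d - 1` to degree `d` leaves a factor `x₀`, so
extension by zero from the chart `x₀ = 1` embeds `RM_{d-1}^σ` into `PRM_d^σ` and preserves weights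
(`extendByZero_mem`). This gives the upper bound and the dimension inequality; the latter is strict
once some codeword is nonzero at infinity.

The lower bound counts non-zeros of a form on `K^(m+1)`, with `Q = |K|`
(`minDist_RM_le_card_eval_ne_zero`). If the form vanishes on a hyperplane, move it to `x₀ = 0`:
dehomogenising gives a word of `RM_{d-1}(m)`. Otherwise every hyperplane section is a nonzero form
in one variable fewer, and induction with a double count of incidences applies. -/

theorem hammingNorm_eq_natCard (x : ι → k) : hammingNorm x = Nat.card {i // x i ≠ 0} := by
  classical
  rw [hammingNorm, Nat.card_eq_fintype_card, Fintype.card_subtype]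

theorem minDist_le_hammingNorm {C : Submodule k (ι → k)} {x : ι → k} (hx : x ∈ C) (h0 : x ≠ 0) :
    minDist C ≤ hammingNorm x :=
  Nat.sInf_le ⟨x, hx, 0, C.zero_mem, h0, by simp⟩

theorem exists_hammingNorm_eq_minDist {C : Submodule k (ι → k)} {x : ι → k} (hx : x ∈ C)
    (h0 : x ≠ 0) : ∃ c ∈ C, c ≠ 0 ∧ hammingNorm c = minDist C := by
  obtain ⟨a, ha, b, hb, hab, h⟩ : minDist C ∈ {n | ∃ x ∈ C, ∃ y ∈ C, x ≠ y ∧ hammingDist x y = n} :=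
    Nat.sInf_mem ⟨_, x, hx, 0, C.zero_mem, h0, rfl⟩
  exact ⟨-a + b, C.add_mem (C.neg_mem ha) hb, fun h' => hab (neg_add_eq_zero.1 h'),
    by rw [← h, hammingDist_eq_hammingNorm]⟩

end MinDist

/-! ### Linear substitution, dehomogenisation and homogenisation. -/

section Polynomials

variable {K : Type*} [Field K]

theorem mem_RM {d m : ℕ} {c : (Fin m → K) → K} :
    c ∈ RM K d m ↔ ∃ g : MvPolynomial (Fin m) K, g.totalDegree ≤ d ∧
      ∀ y, MvPolynomial.eval y g = c y := by
  simp [RM, Submodule.mem_map, MvPolynomial.mem_restrictTotalDegree, affEval, funext_iff,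
    MvPolynomial.aeval_eq_eval]

theorem mem_PRM {d m : ℕ} {c : ProjPoint K m → K} :
    c ∈ PRM K d m ↔ ∃ f : MvPolynomial (Fin (m + 1)) K, f.IsHomogeneous d ∧
      ∀ P : ProjPoint K m, MvPolynomial.eval P.1 f = c P := by
  simp [PRM, Submodule.mem_map, MvPolynomial.mem_homogeneousSubmodule, projEval, funext_iff,
    MvPolynomial.aeval_eq_eval]

/-- Serves both to change coordinates and to restrict a form to a hyperplane. -/
theorem exists_isHomogeneous_eval_comp {d k n : ℕ} {f : MvPolynomial (Fin n) K}
    (hf : f.IsHomogeneous d) (L : (Fin k → K) →ₗ[K] (Fin n → K)) :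
    ∃ g : MvPolynomial (Fin k) K, g.IsHomogeneous d ∧
      ∀ y, MvPolynomial.eval y g = MvPolynomial.eval (L y) f := by
  classical
  refine ⟨MvPolynomial.aeval (fun i => ∑ j, MvPolynomial.C (L (Pi.single j 1) i) *
    MvPolynomial.X j) f, ?_, fun y => ?_⟩
  · rw [← one_mul d]
    exact hf.aeval (n := 1) _ fun i => MvPolynomial.IsHomogeneous.sum _ _ _ fun j _ =>
      MvPolynomial.isHomogeneous_C_mul_X _ _
  · have h : MvPolynomial.eval (L y) f = MvPolynomial.eval (fun i => MvPolynomial.eval y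
        (∑ j, MvPolynomial.C (L (Pi.single j 1) i) * MvPolynomial.X j)) f := by
      congr 2
      ext i
      have hsingle (j : Fin k) : (fun l => if j = l then (1 : K) else 0) = Pi.single j 1 :=
        funext fun l => by simp [Pi.single_apply, eq_comm]
      simp [LinearMap.pi_apply_eq_sum_univ L y, hsingle, mul_comm]
    rw [h]
    change MvPolynomial.eval y (MvPolynomial.bind₁ _ f) = _
    rw [← MvPolynomial.aeval_eq_eval, MvPolynomial.aeval_bind₁]
    simp [MvPolynomial.aeval_eq_eval]

theorem eval_smul_of_isHomogeneous {σ : Type*} {d : ℕ} {f : MvPolynomial σ K}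
    (hf : f.IsHomogeneous d) (t : K) (x : σ → K) :
    MvPolynomial.eval (t • x) f = t ^ d * MvPolynomial.eval x f := by
  rw [MvPolynomial.eval_eq, MvPolynomial.eval_eq, Finset.mul_sum]
  refine Finset.sum_congr rfl fun s hs => ?_
  have h := hf (MvPolynomial.mem_support_iff.1 hs)
  simp only [Finsupp.weight_apply, Finsupp.sum, Pi.one_apply, smul_eq_mul, mul_one] at h
  simp only [Pi.smul_apply, smul_eq_mul, mul_pow, Finset.prod_mul_distrib,
    Finset.prod_pow_eq_pow_sum, h]
  ring

theorem eval_cons_monomial {m : ℕ} (t : K) (y : Fin m → K) (s : Fin (m + 1) →₀ ℕ) (c : K) :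
    MvPolynomial.eval (Fin.cons t y : Fin (m + 1) → K) (MvPolynomial.monomial s c) =
      t ^ s 0 * MvPolynomial.eval y (MvPolynomial.monomial s.tail c) := by
  simp only [MvPolynomial.eval_monomial, Finsupp.prod_fintype, pow_zero, implies_true,
    Fin.prod_univ_succ, Fin.cons_zero, Fin.cons_succ, Finsupp.tail_apply]
  ring

/-- Dehomogenising lowers the degree once the restriction to the hyperplane at infinity is
subtracted. -/
theorem exists_totalDegree_le_eval_cons_one_sub {d m : ℕ} {f : MvPolynomial (Fin (m + 1)) K}
    (hf : f.IsHomogeneous d) :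
    ∃ g : MvPolynomial (Fin m) K, g.totalDegree ≤ d - 1 ∧ ∀ y : Fin m → K,
      MvPolynomial.eval y g = MvPolynomial.eval (Fin.cons 1 y : Fin (m + 1) → K) f -
        MvPolynomial.eval (Fin.cons 0 y : Fin (m + 1) → K) f := by
  -- Monomials free of `x₀` cancel in the difference; the others spend at least one degree on `x₀`.
  refine ⟨∑ s ∈ f.support, if s 0 = 0 then 0 else MvPolynomial.monomial s.tail (f.coeff s),
    ?_, fun y => ?_⟩
  · refine (MvPolynomial.totalDegree_finsetSum _ _).trans (Finset.sup_le fun s hs => ?_)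
    split_ifs with h
    · simp
    · refine (MvPolynomial.totalDegree_monomial_le _ _).trans ?_
      have h1 := hf (MvPolynomial.mem_support_iff.1 hs)
      rw [Finsupp.weight_apply, Finsupp.sum_fintype _ _ (by simp), Fin.sum_univ_succ] at h1
      rw [Finsupp.sum_fintype _ _ (by simp)]
      simp only [Finsupp.tail_apply, Pi.one_apply, smul_eq_mul, mul_one, id] at h1 ⊢
      omega
  · conv_rhs => rw [f.as_sum]
    rw [map_sum, map_sum, map_sum, ← Finset.sum_sub_distrib]
    refine Finset.sum_congr rfl fun s _ => ?_
    rw [eval_cons_monomial, eval_cons_monomial]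
    split_ifs with h <;> simp [h]

/-- A polynomial of degree less than `d` is the dehomogenisation of a form of degree `d` vanishing
on the hyperplane at infinity. -/
theorem exists_isHomogeneous_eval_cons {d m : ℕ} (hd : 1 ≤ d) {g : MvPolynomial (Fin m) K}
    (hg : g.totalDegree ≤ d - 1) :
    ∃ f : MvPolynomial (Fin (m + 1)) K, f.IsHomogeneous d ∧ ∀ y : Fin m → K,
      MvPolynomial.eval (Fin.cons 1 y : Fin (m + 1) → K) f = MvPolynomial.eval y g ∧
        MvPolynomial.eval (Fin.cons 0 y : Fin (m + 1) → K) f = 0 := by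
  have hlt (s) (hs : s ∈ g.support) : s.degree + 1 ≤ d := by
    have := (MvPolynomial.le_totalDegree hs).trans hg
    rw [Finsupp.degree_eq_sum]
    rw [Finsupp.sum_fintype _ _ (by simp)] at this
    omega
  -- The exponent `d - s.degree` of `x₀` is at least 1, hence the vanishing at `x₀ = 0`.
  refine ⟨∑ s ∈ g.support, MvPolynomial.monomial (Finsupp.cons (d - s.degree) s) (g.coeff s),
    ?_, fun y => ⟨?_, ?_⟩⟩
  · refine MvPolynomial.IsHomogeneous.sum _ _ _ fun s hs =>
      MvPolynomial.isHomogeneous_monomial _ ?_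
    have := hlt s hs
    rw [Finsupp.degree_eq_sum, Fin.sum_univ_succ]
    simp only [Finsupp.cons_zero, Finsupp.cons_succ, ← Finsupp.degree_eq_sum]
    omega
  · conv_rhs => rw [g.as_sum]
    rw [map_sum, map_sum]
    exact Finset.sum_congr rfl fun s _ => by rw [eval_cons_monomial]; simp
  · rw [map_sum]
    refine Finset.sum_eq_zero fun s hs => ?_
    have := hlt s hs
    rw [eval_cons_monomial, Finsupp.cons_zero, zero_pow (by omega), zero_mul]

end Polynomials

/-! ### Counting non-zeros of forms. -/

section LowerBound

variable {K : Type*} [Field K]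

theorem finrank_ker_dotProduct {m : ℕ} {x : Fin (m + 1) → K} (hx : x ≠ 0) :
    Module.finrank K (LinearMap.ker (dotProductBilin K K x)) = m := by
  have h0 : dotProductBilin K K x ≠ 0 := fun h => hx (dotProduct_eq_zero x fun w => by
    simpa using LinearMap.congr_fun h w)
  have := Module.Dual.finrank_ker_add_one_of_ne_zero (f := dotProductBilin K K x) h0
  simpa using this

variable [Fintype K]

theorem card_dotProduct_eq_zero {m : ℕ} {x : Fin (m + 1) → K} (hx : x ≠ 0) :
    Nat.card {l : Fin (m + 1) → K // l ⬝ᵥ x = 0} = Fintype.card K ^ m := by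
  have h := Module.natCard_eq_pow_finrank (K := K) (V := LinearMap.ker (dotProductBilin K K x))
  rw [finrank_ker_dotProduct hx, Nat.card_eq_fintype_card (α := K)] at h
  rw [← h]
  exact Nat.card_congr (Equiv.subtypeEquivRight fun l => by simp [dotProduct_comm l x])

variable [DecidableEq K]

omit [Fintype K] [DecidableEq K] in
theorem one_mem_RM (d m : ℕ) : (1 : (Fin m → K) → K) ∈ RM K d m :=
  mem_RM.2 ⟨1, by simp, by simp⟩

/-- The cylinder over a minimum weight word has `|K|` times its weight. -/
theorem minDist_RM_succ_le (d m : ℕ) :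
    minDist (RM K d (m + 1)) ≤ Fintype.card K * minDist (RM K d m) := by
  obtain ⟨c, hc, h0, h⟩ := exists_hammingNorm_eq_minDist (one_mem_RM (K := K) d m) one_ne_zero
  obtain ⟨g, hg, hgc⟩ := mem_RM.1 hc
  have hmem : (fun y : Fin (m + 1) → K => c (Fin.tail y)) ∈ RM K d (m + 1) :=
    mem_RM.2 ⟨MvPolynomial.rename Fin.succ g, (MvPolynomial.totalDegree_rename_le _ _).trans hg,
      fun y => by rw [MvPolynomial.eval_rename, ← hgc]; rfl⟩
  obtain ⟨y, hy⟩ := Function.ne_iff.1 h0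
  refine (minDist_le_hammingNorm hmem (Function.ne_iff.2 ⟨Fin.cons 0 y, by simpa using hy⟩)).trans ?_
  rw [← h, hammingNorm_eq_natCard, hammingNorm_eq_natCard, ← Nat.card_eq_fintype_card,
    ← Nat.card_prod]
  refine Nat.card_le_card_of_injective
    (fun z => (z.1 0, (⟨Fin.tail z.1, z.2⟩ : {y : Fin m → K // c y ≠ 0}))) fun a b hab => ?_
  simp only [Prod.mk.injEq, Subtype.mk.injEq] at hab
  ext1
  rw [← Fin.cons_self_tail a.1, ← Fin.cons_self_tail b.1, hab.1, hab.2]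

/-- The bound for a form that vanishes on a hyperplane but not everywhere. -/
theorem minDist_RM_le_of_vanishing_hyperplane {d m : ℕ}
    {f : MvPolynomial (Fin (m + 1)) K} (hf : f.IsHomogeneous d) {x₀ : Fin (m + 1) → K}
    (h₀ : MvPolynomial.eval x₀ f ≠ 0) {l : Fin (m + 1) → K}
    (h : ∀ x, l ⬝ᵥ x = 0 → MvPolynomial.eval x f = 0) :
    (Fintype.card K - 1) * minDist (RM K (d - 1) m) ≤
      Nat.card {x // MvPolynomial.eval x f ≠ 0} := by
  have hl₀ : l ⬝ᵥ x₀ ≠ 0 := fun h' => h₀ (h _ h')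
  have hl : l ≠ 0 := by rintro rfl; simp at hl₀
  let v : Fin (m + 1) → K := (l ⬝ᵥ x₀)⁻¹ • x₀
  have hv : l ⬝ᵥ v = 1 := by simp [v, dotProduct_smul, hl₀]
  let e : (Fin m → K) ≃ₗ[K] LinearMap.ker (dotProductBilin K K l) :=
    LinearEquiv.ofFinrankEq _ _ (by rw [finrank_ker_dotProduct hl]; simp)
  have hle (y) : l ⬝ᵥ (e y : Fin (m + 1) → K) = 0 := LinearMap.mem_ker.1 (e y).2
  -- Coordinates in which `l` is the coordinate `x₀`: `A` sends `(t, y)` to `t • v + e y`, with `e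
  -- y` in the kernel of `l`.
  let A : (Fin (m + 1) → K) →ₗ[K] (Fin (m + 1) → K) :=
    (LinearMap.proj 0).smulRight v +
      (Submodule.subtype _ ∘ₗ e.toLinearMap) ∘ₗ LinearMap.funLeft K K Fin.succ
  have hA (t : K) (y : Fin m → K) : A (Fin.cons t y) = t • v + (e y : Fin (m + 1) → K) := by
    simp only [A, LinearMap.add_apply, LinearMap.smulRight_apply, LinearMap.proj_apply,
      Fin.cons_zero, LinearMap.comp_apply]
    rfl
  have hlA (t : K) (y : Fin m → K) : l ⬝ᵥ A (Fin.cons t y) = t := by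
    rw [hA, dotProduct_add, dotProduct_smul, hv, hle]; simp
  obtain ⟨p, hp, hpf⟩ := exists_isHomogeneous_eval_comp hf A
  obtain ⟨g, hg, hgp⟩ := exists_totalDegree_le_eval_cons_one_sub hp
  have hgf (y) : MvPolynomial.eval y g = MvPolynomial.eval (A (Fin.cons 1 y)) f := by
    rw [hgp, hpf, hpf, h _ (hlA 0 y), sub_zero]
  have hne : (fun y => MvPolynomial.eval y g) ≠ 0 := by
    -- At `y = 0` the point is `v`, a nonzero multiple of `x₀`.
    refine Function.ne_iff.2 ⟨0, ?_⟩
    simp only [hgf, hA, map_zero, one_smul, ZeroMemClass.coe_zero, add_zero, Pi.zero_apply, v]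
    rw [eval_smul_of_isHomogeneous hf]
    exact mul_ne_zero (pow_ne_zero _ (inv_ne_zero hl₀)) h₀
  have hw := minDist_le_hammingNorm (mem_RM.2 ⟨g, hg, fun y => rfl⟩) hne
  rw [hammingNorm_eq_natCard] at hw
  refine (Nat.mul_le_mul_left _ hw).trans ?_
  rw [← Fintype.card_units, ← Nat.card_eq_fintype_card, ← Nat.card_prod]
  -- Each non-zero of `g` yields a punctured line of non-zeros of `f`; applying `l` recovers the
  -- scalar.
  refine Nat.card_le_card_of_injective (fun z : Kˣ × {y // MvPolynomial.eval y g ≠ 0} =>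
    (⟨(z.1 : K) • A (Fin.cons 1 z.2.1), ?_⟩ : {x // MvPolynomial.eval x f ≠ 0})) ?_
  · rw [eval_smul_of_isHomogeneous hf, ← hgf]
    exact mul_ne_zero (pow_ne_zero _ z.1.ne_zero) z.2.2
  · rintro ⟨t, y, hy⟩ ⟨t', y', hy'⟩ heq
    simp only [Subtype.mk.injEq] at heq
    have ht : (t : K) = t' := by
      simpa [dotProduct_smul, hlA] using congrArg (l ⬝ᵥ ·) heq
    rw [ht] at heq
    have h1 := smul_right_injective _ t'.ne_zero heq
    rw [hA, hA] at h1
    have h2 : y = y' := e.injective (Subtype.ext (add_left_cancel h1))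
    simp [Units.ext ht, h2]

/-- A nonzero form of degree `d` has at least `(|K| - 1) d₁(RM_{d-1}(m))` non-zeros
in `K^(m+1)`. -/
theorem minDist_RM_le_card_eval_ne_zero {d : ℕ} (hd : 1 ≤ d) (m : ℕ) :
    ∀ {f : MvPolynomial (Fin (m + 1)) K}, f.IsHomogeneous d →
      ∀ {x₀ : Fin (m + 1) → K}, MvPolynomial.eval x₀ f ≠ 0 →
      (Fintype.card K - 1) * minDist (RM K (d - 1) m) ≤
        Nat.card {x // MvPolynomial.eval x f ≠ 0} := by
  have eval_zero {n : ℕ} {f : MvPolynomial (Fin n) K} (hf : f.IsHomogeneous d) :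
      MvPolynomial.eval 0 f = 0 := by
    have := eval_smul_of_isHomogeneous hf 0 0
    rwa [zero_smul, zero_pow (by omega), zero_mul] at this
  induction m with
  | zero =>
    intro f hf x₀ h₀
    -- On a line the only hyperplane is the origin, where a form of positive degree vanishes.
    refine minDist_RM_le_of_vanishing_hyperplane hf h₀ (l := 1) fun x hx => ?_
    have : x = 0 := by
      ext i
      fin_cases i
      simpa [dotProduct] using hx
    rw [this, eval_zero hf]
  | succ m ih =>
    intro f hf x₀ h₀
    by_cases hl : ∃ l : Fin (m + 2) → K, ∀ x, l ⬝ᵥ x = 0 → MvPolynomial.eval x f = 0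
    · obtain ⟨l, hl⟩ := hl
      exact minDist_RM_le_of_vanishing_hyperplane hf h₀ hl
    push Not at hl
    set D := (Fintype.card K - 1) * minDist (RM K (d - 1) m) with hD
    let S : Finset (Fin (m + 2) → K) := {x | MvPolynomial.eval x f ≠ 0}
    let T : Finset (Fin (m + 2) → K) := {l | l ≠ 0}
    have hS : Nat.card {x // MvPolynomial.eval x f ≠ 0} = S.card := by
      rw [Nat.card_eq_fintype_card, Fintype.card_subtype]
    have hsec (l) (hlT : l ∈ T) : D ≤ (S.filter fun x => l ⬝ᵥ x = 0).card := by
      have hl0 : l ≠ 0 := by simpa [T] using hlT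
      let e : (Fin (m + 1) → K) ≃ₗ[K] LinearMap.ker (dotProductBilin K K l) :=
        LinearEquiv.ofFinrankEq _ _ (by rw [finrank_ker_dotProduct hl0]; simp)
      have hle (y) : l ⬝ᵥ (e y : Fin (m + 2) → K) = 0 := LinearMap.mem_ker.1 (e y).2
      obtain ⟨p, hp, hpf⟩ := exists_isHomogeneous_eval_comp hf (Submodule.subtype _ ∘ₗ e.toLinearMap)
      obtain ⟨x, hx, hxf⟩ := hl l
      have hpx : MvPolynomial.eval (e.symm ⟨x, by simpa using hx⟩) p ≠ 0 := by
        rw [hpf]; simpa using hxf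
      refine (ih hp hpx).trans ?_
      rw [← Fintype.card_coe, ← Nat.card_eq_fintype_card]
      refine Nat.card_le_card_of_injective
        (fun y => ⟨(e y.1 : Fin (m + 2) → K), ?_⟩) fun a b hab => ?_
      · have := y.2
        rw [hpf] at this
        simpa [S, hle] using this
      · simp only [Subtype.mk.injEq] at hab
        exact Subtype.ext (e.injective (Subtype.ext hab))
    have hpt (x) (hx : x ∈ S) :
        (T.filter fun l => l ⬝ᵥ x = 0).card = Fintype.card K ^ (m + 1) - 1 := by
      have hx0 : x ≠ 0 := by
        rintro rfl
        exact (Finset.mem_filter.1 hx).2 (eval_zero hf)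
      rw [← card_dotProduct_eq_zero hx0, Nat.card_eq_fintype_card, Fintype.card_subtype,
        ← Finset.card_erase_of_mem (a := 0) (by simp)]
      congr 1
      ext l
      simp [T]
    have hT : T.card = Fintype.card K ^ (m + 2) - 1 := by
      have : T = Finset.univ.erase 0 := by ext; simp [T]
      rw [this, Finset.card_erase_of_mem (Finset.mem_univ _), Finset.card_univ]
      simp
    -- Double count of pairs `(l, x)` with `l ≠ 0`, `f x ≠ 0` and `l ⬝ᵥ x = 0`.
    have hcount : T.card * D ≤ S.card * (Fintype.card K ^ (m + 1) - 1) := by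
      calc T.card * D ≤ ∑ l ∈ T, (S.filter fun x => l ⬝ᵥ x = 0).card := by
            simpa using Finset.card_nsmul_le_sum T _ D hsec
        _ = ∑ x ∈ S, (T.filter fun l => l ⬝ᵥ x = 0).card :=
            Finset.sum_card_bipartiteAbove_eq_sum_card_bipartiteBelow fun l x => l ⬝ᵥ x = 0
        _ = _ := by rw [Finset.sum_congr rfl hpt]; simp
    have hQ : 1 < Fintype.card K := Fintype.one_lt_card
    have hQm : 1 < Fintype.card K ^ (m + 1) := Nat.one_lt_pow (by omega) hQ
    rw [hS]
    calc (Fintype.card K - 1) * minDist (RM K (d - 1) (m + 1))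
        ≤ (Fintype.card K - 1) * (Fintype.card K * minDist (RM K (d - 1) m)) :=
          Nat.mul_le_mul_left _ (minDist_RM_succ_le _ _)
      _ = Fintype.card K * D := by rw [hD]; ring
      _ ≤ S.card := by
        -- Uses `Q (Q^(m+1) - 1) ≤ Q^(m+2) - 1`.
        refine Nat.le_of_mul_le_mul_right (le_trans ?_ hcount) (Nat.sub_pos_of_lt hQm)
        rw [hT, mul_right_comm]
        refine Nat.mul_le_mul_right _ ?_
        rw [Nat.mul_sub, ← pow_succ', mul_one]
        exact Nat.sub_le_sub_left hQ.le _

omit [Fintype K] [DecidableEq K] in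
theorem exists_smul_projPoint {m : ℕ} {x : Fin (m + 1) → K} (hx : x ≠ 0) :
    ∃ (t : Kˣ) (P : ProjPoint K m), x = (t : K) • P.1 := by
  classical
  have hex : ∃ i, x i ≠ 0 := Function.ne_iff.1 hx
  obtain ⟨i, hi, hmin⟩ := WellFounded.has_min (wellFounded_lt (α := Fin (m + 1))) {i | x i ≠ 0} hex
  refine ⟨Units.mk0 (x i) hi, ⟨(x i)⁻¹ • x, i, by simpa using inv_mul_cancel₀ hi, fun j hj => ?_⟩, ?_⟩
  · have : x j = 0 := by_contra fun h => hmin j h hj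
    simp [this]
  · simp [smul_smul, mul_inv_cancel₀ hi]

/-- The minimum distance of the projective code `PRM_d(m)` is at least that of `RM_{d-1}(m)`. -/
theorem minDist_RM_le_hammingNorm_of_mem_PRM {d m : ℕ} [Fintype (ProjPoint K m)] (hd : 1 ≤ d)
    {c : ProjPoint K m → K} (hc : c ∈ PRM K d m) (h0 : c ≠ 0) : minDist (RM K (d - 1) m) ≤ hammingNorm c := by
  obtain ⟨f, hf, hfc⟩ := mem_PRM.1 hc
  obtain ⟨P, hP⟩ := Function.ne_iff.1 h0
  have h1 := minDist_RM_le_card_eval_ne_zero hd m hf (x₀ := P.1) (by rw [hfc]; exact hP)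
  have h2 : Nat.card {x // MvPolynomial.eval x f ≠ 0} ≤ (Fintype.card K - 1) * hammingNorm c := by
    rw [hammingNorm_eq_natCard, ← Fintype.card_units, ← Nat.card_eq_fintype_card, ← Nat.card_prod]
    -- Every non-zero of `f` is a unit multiple of a representative in the support of `c`.
    refine Nat.card_le_card_of_surjective (fun z : Kˣ × {P // c P ≠ 0} =>
      (⟨(z.1 : K) • z.2.1.1, ?_⟩ : {x // MvPolynomial.eval x f ≠ 0})) ?_
    · rw [eval_smul_of_isHomogeneous hf, hfc]
      exact mul_ne_zero (pow_ne_zero _ z.1.ne_zero) z.2.2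
    · rintro ⟨x, hx⟩
      have hx0 : x ≠ 0 := by
        rintro rfl
        have := eval_smul_of_isHomogeneous hf 0 0
        rw [zero_smul, zero_pow (by omega), zero_mul] at this
        exact hx this
      obtain ⟨t, P, rfl⟩ := exists_smul_projPoint hx0
      refine ⟨(t, ⟨P, ?_⟩), rfl⟩
      rw [eval_smul_of_isHomogeneous hf, hfc] at hx
      exact right_ne_zero_of_mul hx
  exact Nat.le_of_mul_le_mul_left (h1.trans h2) (Nat.sub_pos_of_lt Fintype.one_lt_card)

end LowerBound

/-! ### Extension by zero from the affine chart. -/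

section Extension

variable {K : Type*} [Field K]

/-- The point of `P^m` with affine coordinates `y` in the chart `x₀ = 1`. -/
def affinePoint {m : ℕ} (y : Fin m → K) : ProjPoint K m :=
  ⟨Fin.cons 1 y, 0, by simp, fun j hj => absurd hj (Fin.not_lt_zero j)⟩

theorem affinePoint_injective {m : ℕ} : Function.Injective (affinePoint (K := K) (m := m)) :=
  fun _ _ h => (Fin.cons_inj (α := fun _ => K).1 (congrArg Subtype.val h)).2

theorem ProjPoint.eq_affinePoint_or_zero {m : ℕ} (P : ProjPoint K m) :
    (∃ y, P = affinePoint y) ∨ P.1 0 = 0 := by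
  obtain ⟨x, i, hi, hlt⟩ := P
  rcases eq_or_ne i 0 with rfl | h
  · exact Or.inl ⟨Fin.tail x, Subtype.ext (by simp [affinePoint, ← hi])⟩
  · exact Or.inr (hlt 0 (Fin.pos_of_ne_zero h))

variable (F : Type*) [Field F]

open Classical in
/-- Extension of words on `K^m` to `P^m` by zero outside of the chart `x₀ = 1`. -/
noncomputable def extendByZero (K : Type*) [Field K] (m : ℕ) :
    ((Fin m → K) → F) →ₗ[F] (ProjPoint K m → F) where
  toFun c P := if P.1 0 = 0 then 0 else c (Fin.tail P.1)
  map_add' a b := by ext P; dsimp; split_ifs <;> simp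
  map_smul' r a := by ext P; dsimp; split_ifs <;> simp

variable {F}

theorem extendByZero_affinePoint {m : ℕ} (c : (Fin m → K) → F) (y : Fin m → K) :
    extendByZero F K m c (affinePoint y) = c y := by
  simp [extendByZero, affinePoint]

theorem extendByZero_of_eq_zero {m : ℕ} (c : (Fin m → K) → F) {P : ProjPoint K m}
    (hP : P.1 0 = 0) : extendByZero F K m c P = 0 := by
  simp [extendByZero, hP]

theorem extendByZero_injective {m : ℕ} : Function.Injective (extendByZero F K m) :=
  fun a b h => funext fun y => by
    rw [← extendByZero_affinePoint a, ← extendByZero_affinePoint b, h]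

theorem hammingNorm_extendByZero [DecidableEq F] {m : ℕ} [Fintype (Fin m → K)]
    [Fintype (ProjPoint K m)] (c : (Fin m → K) → F) :
    hammingNorm (extendByZero F K m c) = hammingNorm c := by
  rw [hammingNorm_eq_natCard, hammingNorm_eq_natCard]
  refine (Nat.card_congr (Equiv.ofBijective (fun y : {y // c y ≠ 0} =>
    (⟨affinePoint y.1, by rw [extendByZero_affinePoint]; exact y.2⟩ :
      {P // extendByZero F K m c P ≠ 0})) ⟨?_, ?_⟩)).symm
  · exact fun a b h => Subtype.ext (affinePoint_injective (congrArg Subtype.val h))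
  · rintro ⟨P, hP⟩
    rcases P.eq_affinePoint_or_zero with ⟨y, rfl⟩ | h
    · exact ⟨⟨y, by rwa [extendByZero_affinePoint] at hP⟩, rfl⟩
    · exact absurd (extendByZero_of_eq_zero c h) hP

theorem extendByZero_mem [Algebra F K] {d m : ℕ} (hd : 1 ≤ d) {c : (Fin m → K) → F}
    (hc : c ∈ subfieldSubcode F (RM K (d - 1) m)) :
    extendByZero F K m c ∈ subfieldSubcode F (PRM K d m) := by
  obtain ⟨g, hg, hgc⟩ := mem_RM.1 hc
  obtain ⟨f, hf, hfg⟩ := exists_isHomogeneous_eval_cons hd hg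
  refine mem_PRM.2 ⟨f, hf, fun P => ?_⟩
  rcases P.eq_affinePoint_or_zero with ⟨y, rfl⟩ | h
  · rw [extendByZero_affinePoint, ← hgc, ← (hfg y).1]; rfl
  · rw [extendByZero_of_eq_zero c h, map_zero]
    refine Eq.trans ?_ (hfg (Fin.tail P.1)).2
    congr 2
    conv_lhs => rw [← Fin.cons_self_tail P.1]
    exact congrArg (Fin.cons (α := fun _ => K) · _) h

end Extension

end ReedMuller

/-! ### The comparison of the two subfield subcodes. -/

theorem mainTheorem11 {F K : Type*} [Field F] [Fintype F] [DecidableEq F]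
    [Field K] [Fintype K] [DecidableEq K] [Algebra F K]
    (q s m d : ℕ) (hq : Fintype.card F = q) (hs : Module.finrank F K = s)
    (hd1 : 1 ≤ d) (hd2 : d ≤ m * (q ^ s - 1)) :
    ReedMuller.minDist (ReedMuller.RM K (d - 1) m) ≤
        ReedMuller.minDist (ReedMuller.subfieldSubcode F (ReedMuller.PRM K d m)) ∧
      ReedMuller.minDist (ReedMuller.subfieldSubcode F (ReedMuller.PRM K d m)) ≤
        ReedMuller.minDist (ReedMuller.subfieldSubcode F (ReedMuller.RM K (d - 1) m)) ∧
      Module.finrank F (ReedMuller.subfieldSubcode F (ReedMuller.RM K (d - 1) m)) ≤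
        Module.finrank F (ReedMuller.subfieldSubcode F (ReedMuller.PRM K d m)) ∧
      (ReedMuller.Nondegenerate (ReedMuller.subfieldSubcode F (ReedMuller.PRM K d m)) →
        Module.finrank F (ReedMuller.subfieldSubcode F (ReedMuller.RM K (d - 1) m)) <
          Module.finrank F (ReedMuller.subfieldSubcode F (ReedMuller.PRM K d m))) := by
  classical
  -- Ensures that there are points at infinity.
  have hm : m ≠ 0 := by rintro rfl; omega
  let C := ReedMuller.subfieldSubcode F (ReedMuller.RM K (d - 1) m)
  let E := ReedMuller.subfieldSubcode F (ReedMuller.PRM K d m)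
  have hinj := ReedMuller.extendByZero_injective (F := F) (K := K) (m := m)
  have hle : C.map (ReedMuller.extendByZero F K m) ≤ E :=
    Submodule.map_le_iff_le_comap.2 fun c hc => ReedMuller.extendByZero_mem hd1 hc
  have hrank : Module.finrank F (C.map (ReedMuller.extendByZero F K m)) = Module.finrank F C :=
    (Submodule.equivMapOfInjective _ hinj C).finrank_eq.symm
  obtain ⟨c, hc, hc0, hcw⟩ := ReedMuller.exists_hammingNorm_eq_minDist
    (ReedMuller.one_mem_subfieldSubcode_RM F K (d - 1) m) one_ne_zero
  have hcE := ReedMuller.extendByZero_mem hd1 hc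
  have hcE0 : ReedMuller.extendByZero F K m c ≠ 0 := (map_ne_zero_iff _ hinj).2 hc0
  refine ⟨?_, ?_, ?_, fun hnd => ?_⟩
  · obtain ⟨b, hb, hb0, hbw⟩ := ReedMuller.exists_hammingNorm_eq_minDist hcE hcE0
    -- Weights agree over `F` and `K`, so the bound for `PRM_d` over `K` applies to `b`.
    have hmap : hammingNorm (fun P => algebraMap F K (b P)) = hammingNorm b :=
      hammingNorm_comp (fun _ => algebraMap F K) (fun _ => (algebraMap F K).injective)
        (fun _ => map_zero _)
    rw [← hbw, ← hmap]
    refine ReedMuller.minDist_RM_le_hammingNorm_of_mem_PRM hd1 hb ?_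
    rw [← hammingNorm_ne_zero_iff, hmap]
    exact hammingNorm_ne_zero_iff.2 hb0
  · rw [← hcw, ← ReedMuller.hammingNorm_extendByZero]
    exact ReedMuller.minDist_le_hammingNorm hcE hcE0
  · exact hrank.ge.trans (Submodule.finrank_mono hle)
  · refine hrank.ge.trans_lt (Submodule.finrank_lt_finrank_of_lt (hle.lt_of_ne fun heq => ?_))
    -- The point `(0, …, 0, 1)` lies at infinity, where all extended words vanish.
    let P : ReedMuller.ProjPoint K m := ⟨Pi.single (Fin.last m) 1, Fin.last m, by simp,
      fun j hj => Pi.single_eq_of_ne hj.ne _⟩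
    have hP : P.1 0 = 0 := Pi.single_eq_of_ne (by simpa [Fin.ext_iff] using hm.symm) _
    obtain ⟨b, hb, hbP⟩ := hnd P
    obtain ⟨a, -, rfl⟩ : b ∈ C.map (ReedMuller.extendByZero F K m) := heq ▸ hb
    exact hbP (ReedMuller.extendByZero_of_eq_zero a hP)
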